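/- Let $\mathcal B$ be a braided monoidal category with braiding $c$ and unit $I$, and let $\mathcal M$ be a left $\mathcal B$-module category with action $\triangleright$; associativity and unit isomorphisms are suppressed in the notation. **Coendomorphism objects.** A coendomorphism object of $\mathcal B$ is an object $H$ with a natural transformation $\delta_X\colon X\to X\otimes H$ ($X\in\mathcal B$) such that for every $T\in\mathcal B$ the map $\mathcal B(H,T)\to\mathrm{Nat}_X(X,X\otimes T)$, $f\mapsto (X\otimes f)\delta_X$, is bijective. It is *strong* if for all $P,T\in\mathcal B$ the map $\mathcal B(H\otimes P,T)\to \mathrm{Nat}_X(X\otimes P,X\otimes T)$, $f\mapsto (X\otimes f)(\delta_X\otimes P)$, is bijective, and *$\mathcal M$-strong* if for all $P,T\in\mathcal M$ the map $\mathcal M(H\triangleright P,T)\to\mathrm{Nat}_X(X\triangleright P,X\triangleright T)$, $f\mapsto (X\triangleright f)(\delta_X\triangleright P)$, is bijective. A strong coendomorphism object $H$ carries a canonical bialgebra structure in $\mathcal B$: its comultiplication and counit are the morphisms for which every $\delta_X$ is a comodule structure, its unit is $\delta_I\colon I\to I\otimes H= H$, and its multiplication $m$ is determined by $\delta_{X\otimes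 Y}=(X\otimes Y\otimes m)(X\otimes c_{H,Y}\otimes H)(\delta_X\otimes\delta_Y)$. The canonical half-braiding $\sigma_Y\colon H\otimes Y\to Y\otimes H$ is determined by $(X\otimes\sigma_Y)(\delta_X\otimes Y)=(c_{Y,X}\otimes H)(Y\otimes\delta_X)c_{X,Y}$ for all $X$. **Reflective center.** For $V\in\mathcal M$, consider families $e_X\colon X\triangleright V\to X\triangleright V$, natural in $X\in\mathcal B$, which satisfy the module-braiding equations $$e_I=\mathrm{id}_V,\qquad e_{X\otimes Y}=(X\triangleright e_Y)(c_{Y,X}\triangleright V)(Y\triangleright e_X)(c_{Y,X}^{-1}\triangleright V)\quad (X,Y\in\mathcal B).\tag{$*$}$$ The reflective center $\mathcal E_{\mathcal B}(\mathcal M)$ is the category of pairs $(V,e)$ in which $V\in\mathcal M$ and $e$ is such a family consisting of isomorphisms; its morphisms are the morphisms of $\mathcal M$ that commute with the $e_X$. The category ${}_H\mathcal M$ is the category of left $H$-modules in $\mathcal M$, that is, of objects $V\in\mathcal M$ with an associative and unital action $\gamma\colon H\triangleright V\to V$. **Theorem.** Let $H$ be a strong coendomorphism object of $\mathcal B$ whose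 canonical bialgebra structure is a Hopf algebra (i.e. has an antipode), and suppose that $H$ is $\mathcal M$-strong. Then: 1. There is an equivalence of categories $\mathcal E_{\mathcal B}(\mathcal M)\simeq{}_H\mathcal M$, compatible up to natural isomorphism with the forgetful functors to $\mathcal M$, under which (via that isomorphism) the module braiding $e$ of an object and the corresponding action $\gamma$ are related by $e_X=(X\triangleright\gamma)(\delta_X\triangleright V)$ for all $X\in\mathcal B$. 2. For every $H$-module $(V,\gamma)$ in $\mathcal M$ the family $e^\gamma_X:=(X\triangleright\gamma)(\delta_X\triangleright V)$ is natural in $X$ and satisfies $(*)$. 3. Conversely, if $V\in\mathcal M$ and $e_X\colon X\triangleright V\to X\triangleright V$ is any family natural in $X\in\mathcal B$ that satisfies $(*)$, invertibility not being assumed, then $e=e^\gamma$ for a unique $H$-module structure $\gamma$ on $V$, and every $e_X$ is an isomorphism. 4. The correspondence is compatible with the actions of $\mathcal B$: if $(V,\gamma)$ is an $H$-module in $\mathcal M$ and $Y\in\mathcal B$, then $\gamma':=(Y\triangleright\gamma)(\sigma_Y\triangleright V)$ is an $H$-module structure on $Y\triangleright V$, and $e^{\gamma'}_X=(c_{Y,X}\triangleright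 V)(Y\triangleright e^{\gamma}_X)(c_{X,Y}\triangleright V)$ for all $X\in\mathcal B$. -/

import Mathlib

open CategoryTheory MonoidalCategory MonoidalLeftAction MonObj ComonObj

universe v₁ v₂ u₁ u₂

namespace ReflCenter

section Coend

/-- A coendomorphism object of a braided monoidal category `B` (that is, of the identity functor
of `B`): an object `H` with a natural transformation `coact X : X ⟶ X ⊗ H` such that, for every `T`,
`f ↦ coact ≫ (- ◁ f)` is a bijection from `H ⟶ T` to natural transformations `X ⟶ X ⊗ T`. -/
structure Coendomorphism {B : Type u₁} [Category.{v₁} B] [MonoidalCategory B] (H : B) where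
  /-- the universal coaction -/
  coact : ∀ X : B, X ⟶ X ⊗ H
  naturality : ∀ {X Y : B} (f : X ⟶ Y), f ≫ coact Y = coact X ≫ f ▷ H
  universal : ∀ (T : B) (t : ∀ X : B, X ⟶ X ⊗ T),
    (∀ {X Y : B} (f : X ⟶ Y), f ≫ t Y = t X ≫ f ▷ T) →
      ∃! f : H ⟶ T, ∀ X, t X = coact X ≫ X ◁ f

variable {B : Type u₁} [Category.{v₁} B] [MonoidalCategory B]

/-- A coendomorphism object is strong if, for all `P` and `T`, the map `f ↦ (- ◁ f) ∘ (coact ▷ P)` is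
a bijection from `H ⊗ P ⟶ T` to natural transformations `X ⊗ P ⟶ X ⊗ T`. -/
def Coendomorphism.IsStrong {H : B} (c : Coendomorphism H) : Prop :=
  ∀ (P T : B) (t : ∀ X : B, X ⊗ P ⟶ X ⊗ T),
    (∀ {X Y : B} (f : X ⟶ Y), f ▷ P ≫ t Y = t X ≫ f ▷ T) →
      ∃! f : H ⊗ P ⟶ T, ∀ X, t X = c.coact X ▷ P ≫ (α_ X H P).hom ≫ X ◁ f

/-- The transformation `X ⊙ P ⟶ X ⊙ T` induced by `f : H ⊙ P ⟶ T`: coact on `X` with `H`, then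
apply `f`. -/
def Coendomorphism.induced {H : B} (c : Coendomorphism H)
    {M : Type u₂} [Category.{v₂} M] [MonoidalLeftAction B M] {P T : M}
    (f : H ⊙ₗ P ⟶ T) (X : B) : X ⊙ₗ P ⟶ X ⊙ₗ T :=
  c.coact X ⊵ₗ P ≫ (αₗ X H P).hom ≫ X ⊴ₗ f

/-- A coendomorphism object is `M`-strong, for a `B`-module category `M`, if for all `P` and `T`
in `M` the map `f ↦ c.induced f` is a bijection from `H ⊙ P ⟶ T` to natural transformations
`X ⊙ P ⟶ X ⊙ T`. -/
def Coendomorphism.IsStrongOver {H : B} (c : Coendomorphism H)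
    (M : Type u₂) [Category.{v₂} M] [MonoidalLeftAction B M] : Prop :=
  ∀ (P T : M) (t : ∀ X : B, X ⊙ₗ P ⟶ X ⊙ₗ T),
    (∀ {X Y : B} (f : X ⟶ Y), f ⊵ₗ P ≫ t Y = t X ≫ f ⊵ₗ T) →
      ∃! f : H ⊙ₗ P ⟶ T, ∀ X, t X = c.induced f X

/-- Joint cancellation property of a family of morphisms `A i ⟶ A i ⊗ K`. -/
def Separating {I : Type*} {A : I → B} {K : B} (ξ : ∀ i, A i ⟶ A i ⊗ K) : Prop :=
  ∀ (P T : B) (f g : K ⊗ P ⟶ T),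
    (∀ i, ξ i ▷ P ≫ (α_ _ _ _).hom ≫ A i ◁ f = ξ i ▷ P ≫ (α_ _ _ _).hom ≫ A i ◁ g) → f = g

theorem Separating.eq {I : Type*} {A : I → B} {K : B} {ξ : ∀ i, A i ⟶ A i ⊗ K}
    (h : Separating ξ) {T : B} {f g : K ⟶ T} (hfg : ∀ i, ξ i ≫ A i ◁ f = ξ i ≫ A i ◁ g) :
    f = g := by
  have key := h (𝟙_ B) T ((ρ_ K).hom ≫ f) ((ρ_ K).hom ≫ g) (fun i => by
    have e : ∀ f : K ⟶ T, ξ i ▷ 𝟙_ B ≫ (α_ _ _ _).hom ≫ A i ◁ ((ρ_ K).hom ≫ f) =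
        (ρ_ _).hom ≫ ξ i ≫ A i ◁ f := fun f => by monoidal
    rw [e, e, hfg i])
  exact (cancel_epi _).1 key

variable {H : B} (c : Coendomorphism H)

theorem Coendomorphism.separating (hc : c.IsStrong) : Separating c.coact := by
  intro P T f g h
  refine (hc P T (fun X => c.coact X ▷ P ≫ (α_ _ _ _).hom ≫ X ◁ f) ?_).unique
    (fun X => rfl) (fun X => h X)
  intro X Y k
  have h1 := c.naturality k
  rw [← comp_whiskerRight_assoc, h1]
  simp [whisker_exchange]

theorem Coendomorphism.exists_counit : ∃ e : H ⟶ 𝟙_ B, ∀ X, c.coact X ≫ X ◁ e = (ρ_ X).inv := by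
  obtain ⟨e, he, -⟩ := c.universal (𝟙_ B) (fun X => (ρ_ X).inv) (fun f => by simp)
  exact ⟨e, fun X => (he X).symm⟩

theorem Coendomorphism.exists_comul : ∃ d : H ⟶ H ⊗ H, ∀ X,
    c.coact X ≫ X ◁ d = c.coact X ≫ c.coact X ▷ H ≫ (α_ X H H).hom := by
  obtain ⟨e, he, -⟩ := c.universal (H ⊗ H) (fun X => c.coact X ≫ c.coact X ▷ H ≫ (α_ X H H).hom)
    (fun {X Y} f => by
      have h := c.naturality f
      rw [← Category.assoc, h, Category.assoc, ← comp_whiskerRight_assoc, h]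
      simp)
  exact ⟨e, fun X => (he X).symm⟩

/-- The counit of `H`: the morphism for which every `coact X` is counital. -/
noncomputable def Coendomorphism.counit : H ⟶ 𝟙_ B := c.exists_counit.choose

/-- The comultiplication of `H`: the morphism for which every `coact X` is coassociative. -/
noncomputable def Coendomorphism.comul : H ⟶ H ⊗ H := c.exists_comul.choose

theorem Coendomorphism.counit_spec (X : B) : c.coact X ≫ X ◁ c.counit = (ρ_ X).inv :=
  c.exists_counit.choose_spec X

theorem Coendomorphism.comul_spec (X : B) :
    c.coact X ≫ X ◁ c.comul = c.coact X ≫ c.coact X ▷ H ≫ (α_ X H H).hom :=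
  c.exists_comul.choose_spec X

/-- The unit of `H`: the coaction on the unit object. -/
def Coendomorphism.one : 𝟙_ B ⟶ H := c.coact (𝟙_ B) ≫ (λ_ H).hom

theorem Coendomorphism.coact_unit : c.coact (𝟙_ B) = c.one ≫ (λ_ H).inv := by
  simp [Coendomorphism.one]

variable [BraidedCategory B]

/-- The coaction of `H ⊗ H` on `X ⊗ Y`: coact on both factors, and use the braiding of `B` to move
the first copy of `H` past `Y`. -/
def Coendomorphism.coact₂ (X Y : B) : X ⊗ Y ⟶ (X ⊗ Y) ⊗ (H ⊗ H) :=
  (c.coact X ⊗ₘ c.coact Y) ≫ tensorμ X H Y H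

theorem Separating.tensor {I J : Type*} {A : I → B} {D : J → B} {K L : B}
    {ξ : ∀ i, A i ⟶ A i ⊗ K} {ζ : ∀ i, D i ⟶ D i ⊗ L} (hξ : Separating ξ) (hζ : Separating ζ) :
    Separating (I := I × J) (A := fun p => A p.1 ⊗ D p.2)
      (fun p => (ξ p.1 ⊗ₘ ζ p.2) ≫ tensorμ (A p.1) K (D p.2) L) := by
  intro P T f g h
  have e1 : ∀ (i : I) (j : J) (f : (K ⊗ L) ⊗ P ⟶ T),
      ((ξ i ⊗ₘ ζ j) ≫ tensorμ (A i) K (D j) L) ▷ P ≫ (α_ _ _ _).hom ≫ (A i ⊗ D j) ◁ f =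
      (α_ _ _ _).hom ≫ (ξ i ▷ (D j ⊗ P) ≫ (α_ _ _ _).hom ≫
        A i ◁ (K ◁ (ζ j ▷ P) ≫ (α_ K (D j ⊗ L) P).inv ≫
          ((α_ _ _ _).inv ≫ (β_ K (D j)).hom ▷ L ≫ (α_ _ _ _).hom) ▷ P ≫
            (α_ _ _ _).hom ≫ D j ◁ f)) ≫ (α_ _ _ _).inv := by
    intro i j f
    rw [MonoidalCategory.tensorHom_def]
    simp only [tensorμ]
    monoidal
  have e2 : ∀ (j : J) (f : (K ⊗ L) ⊗ P ⟶ T),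
      ((α_ _ _ _).inv ≫ (β_ K (D j)).inv ▷ P ≫ (α_ _ _ _).hom) ≫
        (K ◁ (ζ j ▷ P) ≫ (α_ K (D j ⊗ L) P).inv ≫
          ((α_ _ _ _).inv ≫ (β_ K (D j)).hom ▷ L ≫ (α_ _ _ _).hom) ▷ P ≫
            (α_ _ _ _).hom ≫ D j ◁ f) =
      ζ j ▷ (K ⊗ P) ≫ (α_ _ _ _).hom ≫
        D j ◁ ((α_ _ _ _).inv ≫ (β_ K L).inv ▷ P ≫ f) := by
    intro j f
    have h1 : (β_ K (D j)).inv ≫ K ◁ ζ j = ζ j ▷ K ≫ (β_ K (D j ⊗ L)).inv := by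
      rw [Iso.inv_comp_eq, ← Category.assoc, ← BraidedCategory.braiding_naturality_right,
        Category.assoc, Iso.hom_inv_id, Category.comp_id]
    have h2 : (β_ K (D j ⊗ L)).inv ≫ (α_ _ _ _).inv ≫ (β_ K (D j)).hom ▷ L ≫ (α_ _ _ _).hom =
        (α_ _ _ _).hom ≫ D j ◁ (β_ K L).inv := by
      simp [BraidedCategory.braiding_tensor_right_inv]
    calc _ = (α_ _ _ _).inv ≫ (((β_ K (D j)).inv ≫ K ◁ ζ j) ≫
          (α_ _ _ _).inv ≫ (β_ K (D j)).hom ▷ L ≫ (α_ _ _ _).hom) ▷ P ≫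
            (α_ _ _ _).hom ≫ D j ◁ f := by monoidal
      _ = _ := by
        rw [h1, Category.assoc, h2]
        monoidal
  have e3 : (α_ _ _ _).inv ≫ (β_ K L).inv ▷ P ≫ f = (α_ _ _ _).inv ≫ (β_ K L).inv ▷ P ≫ g := by
    refine hζ _ _ _ _ fun j => ?_
    rw [← e2, ← e2]
    congr 1
    refine hξ _ _ _ _ fun i => ?_
    have := h (i, j)
    dsimp only at this
    rw [e1, e1] at this
    exact (cancel_mono _).1 ((cancel_epi _).1 this)
  exact (cancel_epi _).1 ((cancel_epi _).1 e3)

theorem Coendomorphism.separating₂ (hc : c.IsStrong) :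
    Separating (I := B × B) (A := fun p => p.1 ⊗ p.2) (fun p => c.coact₂ p.1 p.2) :=
  (c.separating hc).tensor (c.separating hc)

theorem Coendomorphism.exists_mul (hc : c.IsStrong) : ∃ m : H ⊗ H ⟶ H, ∀ X Y,
    c.coact (X ⊗ Y) = c.coact₂ X Y ≫ (X ⊗ Y) ◁ m := by
  have h1 : ∀ Y : B, ∃ F : H ⊗ Y ⟶ Y ⊗ H, ∀ X, c.coact (X ⊗ Y) ≫ (α_ _ _ _).hom =
      c.coact X ▷ Y ≫ (α_ _ _ _).hom ≫ X ◁ F := by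
    intro Y
    obtain ⟨F, hF, -⟩ := hc Y (Y ⊗ H) (fun X => c.coact (X ⊗ Y) ≫ (α_ _ _ _).hom) (fun f => by
      have h := c.naturality (f ▷ Y)
      rw [← Category.assoc, h]
      simp)
    exact ⟨F, hF⟩
  choose F hF using h1
  have hFnat : ∀ {Y Z : B} (k : Y ⟶ Z), H ◁ k ≫ F Z = F Y ≫ k ▷ H := by
    intro Y Z k
    refine c.separating hc _ _ _ _ fun X => ?_
    have h2 := c.naturality (X ◁ k)
    calc _ = X ◁ k ≫ (c.coact X ▷ Z ≫ (α_ _ _ _).hom ≫ X ◁ F Z) := by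
          simp [whisker_exchange_assoc]
      _ = (c.coact X ▷ Y ≫ (α_ _ _ _).hom ≫ X ◁ F Y) ≫ X ◁ k ▷ H := by
          rw [← hF, ← hF, ← Category.assoc, h2]
          simp
      _ = _ := by simp
  obtain ⟨f, hf, -⟩ := hc H H (fun Y => (β_ H Y).inv ≫ F Y) (fun {X Y} k => by
    have : k ▷ H ≫ (β_ H Y).inv = (β_ H X).inv ≫ H ◁ k := by simp
    rw [← Category.assoc, this, Category.assoc, hFnat, Category.assoc])
  refine ⟨(β_ H H).hom ≫ f, fun X Y => ?_⟩
  have h3 : F Y = (β_ H Y).hom ≫ c.coact Y ▷ H ≫ (α_ _ _ _).hom ≫ Y ◁ f := by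
    rw [← hf Y]
    simp
  have h4 : (β_ H Y).hom ≫ c.coact Y ▷ H = H ◁ c.coact Y ≫ (β_ H (Y ⊗ H)).hom :=
    (BraidedCategory.braiding_naturality_right _ _).symm
  rw [← cancel_mono (α_ X Y H).hom, hF, h3, reassoc_of% h4, Coendomorphism.coact₂,
    MonoidalCategory.tensorHom_def, tensorμ, BraidedCategory.braiding_tensor_right_hom]
  monoidal

/-- The multiplication of `H`: the morphism for which the coaction on `X ⊗ Y` is the codiagonal
one. -/
noncomputable def Coendomorphism.mul (hc : c.IsStrong) : H ⊗ H ⟶ H := (c.exists_mul hc).choose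

theorem Coendomorphism.mul_spec (hc : c.IsStrong) (X Y : B) :
    c.coact (X ⊗ Y) = c.coact₂ X Y ≫ (X ⊗ Y) ◁ c.mul hc :=
  (c.exists_mul hc).choose_spec X Y

/-- The coalgebra structure of `H`. -/
@[reducible] noncomputable def Coendomorphism.comonObj (hc : c.IsStrong) : ComonObj H where
  counit := c.counit
  comul := c.comul
  counit_comul := by
    refine (c.separating hc).eq fun X => ?_
    have h1 := c.comul_spec X
    have h2 := c.counit_spec X
    rw [MonoidalCategory.whiskerLeft_comp, reassoc_of% h1]
    calc _ = c.coact X ≫ (c.coact X ≫ X ◁ c.counit) ▷ H ≫ (α_ _ _ _).hom := by monoidal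
      _ = _ := by rw [h2]; monoidal
  comul_counit := by
    refine (c.separating hc).eq fun X => ?_
    have h1 := c.comul_spec X
    have h2 := c.counit_spec X
    rw [MonoidalCategory.whiskerLeft_comp, reassoc_of% h1]
    calc _ = c.coact X ≫ (c.coact X ▷ H ≫ (X ⊗ H) ◁ c.counit) ≫ (α_ _ _ _).hom := by monoidal
      _ = (c.coact X ≫ X ◁ c.counit) ≫ c.coact X ▷ _ ≫ (α_ _ _ _).hom := by
        rw [← whisker_exchange]; simp
      _ = _ := by rw [h2]; monoidal
  comul_assoc := by
    refine (c.separating hc).eq fun X => ?_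
    have h1 := c.comul_spec X
    rw [MonoidalCategory.whiskerLeft_comp, reassoc_of% h1, MonoidalCategory.whiskerLeft_comp,
      reassoc_of% h1]
    calc _ = c.coact X ≫ (c.coact X ▷ H ≫ (X ⊗ H) ◁ c.comul) ≫ (α_ _ _ _).hom := by monoidal
      _ = (c.coact X ≫ X ◁ c.comul) ≫ c.coact X ▷ _ ≫ (α_ _ _ _).hom := by
        rw [← whisker_exchange]; simp
      _ = c.coact X ≫ (c.coact X ≫ c.coact X ▷ H ≫ (α_ _ _ _).hom) ▷ H ≫
          (α_ _ _ _).hom ≫ X ◁ (α_ _ _ _).hom := by rw [h1]; monoidal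
      _ = _ := by rw [← h1]; monoidal

theorem tensorμ_comp_whiskerLeft (X Y : B) {K L K' L' : B} (f : K ⟶ K') (g : L ⟶ L') :
    tensorμ X K Y L ≫ (X ⊗ Y) ◁ (f ⊗ₘ g) = (X ◁ f ⊗ₘ Y ◁ g) ≫ tensorμ X K' Y L' := by
  have := tensorμ_natural (𝟙 X) f (𝟙 Y) g
  simpa using this.symm

theorem tensorμ_comp_whiskerRight (K L : B) {X Y X' Y' : B} (f : X ⟶ X') (g : Y ⟶ Y') :
    tensorμ X K Y L ≫ (f ⊗ₘ g) ▷ (K ⊗ L) = (f ▷ K ⊗ₘ g ▷ L) ≫ tensorμ X' K Y' L := by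
  have := tensorμ_natural f (𝟙 K) g (𝟙 L)
  simpa using this.symm

/-- The algebra structure of `H`. -/
@[reducible] noncomputable def Coendomorphism.monObj (hc : c.IsStrong) : MonObj H where
  one := c.one
  mul := c.mul hc
  one_mul := by
    rw [← cancel_epi (λ_ H).inv, Iso.inv_hom_id]
    refine (c.separating hc).eq fun Y => ?_
    have h1 := c.naturality (λ_ Y).hom
    rw [c.mul_spec hc, Coendomorphism.coact₂, c.coact_unit] at h1
    have h2 := tensorμ_comp_whiskerLeft (𝟙_ B) Y c.one (𝟙 H)
    have h3 := tensor_left_unitality Y H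
    rw [tensorHom_id] at h2
    have h4 : (c.one ≫ (λ_ H).inv ⊗ₘ c.coact Y) ≫ tensorμ (𝟙_ B) H Y H =
        (λ_ Y).hom ≫ c.coact Y ≫ (λ_ (Y ⊗ H)).inv ≫ (λ_ (𝟙_ B)).inv ▷ (Y ⊗ H) ≫
          tensorμ (𝟙_ B) (𝟙_ B) Y H ≫ (𝟙_ B ⊗ Y) ◁ (c.one ▷ H) := by
      rw [h2, whiskerLeft_id, tensorHom_id]
      simp only [← Category.assoc]
      congr 1
      rw [MonoidalCategory.tensorHom_def']
      monoidal
    rw [h4] at h1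
    have h5 : (λ_ (Y ⊗ H)).inv ≫ (λ_ (𝟙_ B)).inv ▷ (Y ⊗ H) ≫ tensorμ (𝟙_ B) (𝟙_ B) Y H =
        (λ_ Y).inv ▷ H ≫ (𝟙_ B ⊗ Y) ◁ (λ_ H).inv := by
      rw [Iso.inv_comp_eq, h3]
      simp [MonoidalCategory.tensorHom_def]
    simp only [Category.assoc] at h1
    rw [reassoc_of% h5, cancel_epi] at h1
    have h6 : (λ_ Y).inv ▷ H ≫ (𝟙_ B ⊗ Y) ◁ (λ_ H).inv ≫ (𝟙_ B ⊗ Y) ◁ (c.one ▷ H) ≫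
        (𝟙_ B ⊗ Y) ◁ c.mul hc ≫ (λ_ Y).hom ▷ H =
          Y ◁ ((λ_ H).inv ≫ c.one ▷ H ≫ c.mul hc) := by
      simp only [whisker_exchange, inv_hom_whiskerRight_assoc, MonoidalCategory.whiskerLeft_comp,
        whisker_exchange_assoc]
    rw [MonoidalCategory.whiskerLeft_id, Category.comp_id, ← h6]
    exact h1.symm
  mul_one := by
    rw [← cancel_epi (ρ_ H).inv, Iso.inv_hom_id]
    refine (c.separating hc).eq fun Y => ?_
    have h1 := c.naturality (ρ_ Y).hom
    rw [c.mul_spec hc, Coendomorphism.coact₂, c.coact_unit] at h1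
    have h2 := tensorμ_comp_whiskerLeft Y (𝟙_ B) (𝟙 H) c.one
    have h3 := tensor_right_unitality Y H
    rw [id_tensorHom] at h2
    have h4 : (c.coact Y ⊗ₘ c.one ≫ (λ_ H).inv) ≫ tensorμ Y H (𝟙_ B) H =
        (ρ_ Y).hom ≫ c.coact Y ≫ (ρ_ (Y ⊗ H)).inv ≫ (Y ⊗ H) ◁ (λ_ (𝟙_ B)).inv ≫
          tensorμ Y H (𝟙_ B) (𝟙_ B) ≫ (Y ⊗ 𝟙_ B) ◁ (H ◁ c.one) := by
      rw [h2, whiskerLeft_id, id_tensorHom]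
      simp only [← Category.assoc]
      congr 1
      rw [MonoidalCategory.tensorHom_def]
      monoidal
    rw [h4] at h1
    have h5 : (ρ_ (Y ⊗ H)).inv ≫ (Y ⊗ H) ◁ (λ_ (𝟙_ B)).inv ≫ tensorμ Y H (𝟙_ B) (𝟙_ B) =
        (ρ_ Y).inv ▷ H ≫ (Y ⊗ 𝟙_ B) ◁ (ρ_ H).inv := by
      rw [Iso.inv_comp_eq, h3]
      simp [MonoidalCategory.tensorHom_def]
    simp only [Category.assoc] at h1
    rw [reassoc_of% h5, cancel_epi] at h1
    have h6 : (ρ_ Y).inv ▷ H ≫ (Y ⊗ 𝟙_ B) ◁ (ρ_ H).inv ≫ (Y ⊗ 𝟙_ B) ◁ (H ◁ c.one) ≫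
        (Y ⊗ 𝟙_ B) ◁ c.mul hc ≫ (ρ_ Y).hom ▷ H =
          Y ◁ ((ρ_ H).inv ≫ H ◁ c.one ≫ c.mul hc) := by
      simp only [whisker_exchange, inv_hom_whiskerRight_assoc, MonoidalCategory.whiskerLeft_comp,
        whisker_exchange_assoc]
    rw [MonoidalCategory.whiskerLeft_id, Category.comp_id, ← h6]
    exact h1.symm
  mul_assoc := by
    refine ((c.separating₂ hc).tensor (c.separating hc)).eq fun p => ?_
    obtain ⟨⟨X, Y⟩, Z⟩ := p
    dsimp only
    have hm := c.mul_spec hc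
    have hn := c.naturality (α_ X Y Z).hom
    have l : ((c.coact₂ X Y ⊗ₘ c.coact Z) ≫ tensorμ (X ⊗ Y) (H ⊗ H) Z H) ≫
        ((X ⊗ Y) ⊗ Z) ◁ (c.mul hc ▷ H ≫ c.mul hc) = c.coact ((X ⊗ Y) ⊗ Z) := by
      have h2 := tensorμ_comp_whiskerLeft (X ⊗ Y) Z (c.mul hc) (𝟙 H)
      rw [tensorHom_id, whiskerLeft_id] at h2
      rw [MonoidalCategory.whiskerLeft_comp, Category.assoc, reassoc_of% h2,
        tensorHom_comp_tensorHom_assoc, ← hm, Category.comp_id, hm (X ⊗ Y) Z,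
        Coendomorphism.coact₂, Category.assoc]
    have r : ((c.coact₂ X Y ⊗ₘ c.coact Z) ≫ tensorμ (X ⊗ Y) (H ⊗ H) Z H) ≫
        ((X ⊗ Y) ⊗ Z) ◁ ((α_ H H H).hom ≫ H ◁ c.mul hc ≫ c.mul hc) =
          (α_ X Y Z).hom ≫ c.coact (X ⊗ Y ⊗ Z) ≫ (α_ X Y Z).inv ▷ H := by
      have h2 := tensorμ_comp_whiskerLeft X (Y ⊗ Z) (𝟙 H) (c.mul hc)
      rw [id_tensorHom, whiskerLeft_id] at h2
      have h3 := tensor_associativity X H Y H Z H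
      have h4 : (c.coact₂ X Y ⊗ₘ c.coact Z) = ((c.coact X ⊗ₘ c.coact Y) ⊗ₘ c.coact Z) ≫
          tensorμ X H Y H ▷ (Z ⊗ H) := by
        rw [Coendomorphism.coact₂, ← tensorHom_id, tensorHom_comp_tensorHom, Category.comp_id]
      have h5 : ((X ⊗ Y) ⊗ Z) ◁ (α_ H H H).hom =
          ((α_ X Y Z).hom ⊗ₘ (α_ H H H).hom) ≫ (α_ X Y Z).inv ▷ (H ⊗ H ⊗ H) := by
        simp [← tensorHom_id, ← id_tensorHom]
      have h6 : c.coact X ⊗ₘ c.coact (Y ⊗ Z) =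
          (c.coact X ⊗ₘ c.coact Y ⊗ₘ c.coact Z) ≫ (X ⊗ H) ◁ tensorμ Y H Z H ≫
            (𝟙 (X ⊗ H) ⊗ₘ (Y ⊗ Z) ◁ c.mul hc) := by
        rw [hm Y Z, Coendomorphism.coact₂]
        simp [← id_tensorHom]
      have h7 : c.coact₂ X (Y ⊗ Z) =
          (c.coact X ⊗ₘ c.coact (Y ⊗ Z)) ≫ tensorμ X H (Y ⊗ Z) H := rfl
      rw [hm X (Y ⊗ Z), h7, h6, h4]
      simp only [MonoidalCategory.whiskerLeft_comp, Category.assoc]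
      rw [reassoc_of% h5, reassoc_of% h3, ← whisker_exchange_assoc, ← whisker_exchange,
        reassoc_of% h2, associator_naturality_assoc]
    rw [l, r, ← Category.assoc, hn]
    simp

/-- The bialgebra structure of a strong coendomorphism object. -/
@[reducible] noncomputable def Coendomorphism.bimonObj (hc : c.IsStrong) : BimonObj H :=
  { c.monObj hc, c.comonObj hc with
    mul_comul := by
      refine (c.separating₂ hc).eq fun p => ?_
      obtain ⟨X, Y⟩ := p
      dsimp only
      change c.coact₂ X Y ≫ (X ⊗ Y) ◁ (c.mul hc ≫ c.comul) = c.coact₂ X Y ≫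
        (X ⊗ Y) ◁ ((c.comul ⊗ₘ c.comul) ≫ tensorμ H H H H ≫ (c.mul hc ⊗ₘ c.mul hc))
      have hm := c.mul_spec hc
      have hd := c.comul_spec
      have h1 := tensorμ_comp_whiskerLeft X Y c.comul c.comul
      have h2 := tensorμ_comp_whiskerRight H H (c.coact X) (c.coact Y)
      have h3 := associator_monoidal X H H Y H H
      have h4 : c.coact₂ X Y ≫ (X ⊗ Y) ◁ ((c.comul ⊗ₘ c.comul) ≫ tensorμ H H H H) =
          c.coact₂ X Y ≫ c.coact₂ X Y ▷ (H ⊗ H) ≫ (α_ _ _ _).hom := by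
        rw [Coendomorphism.coact₂, MonoidalCategory.whiskerLeft_comp, Category.assoc,
          reassoc_of% h1, tensorHom_comp_tensorHom_assoc, hd, hd, comp_whiskerRight,
          Category.assoc, Category.assoc, reassoc_of% h2, ← tensorHom_comp_tensorHom_assoc,
          ← tensorHom_comp_tensorHom_assoc, h3]
      have h5 : c.coact₂ X Y ≫ (X ⊗ Y) ◁ (c.mul hc ≫ c.comul) =
          c.coact₂ X Y ≫ (c.coact₂ X Y ▷ (H ⊗ H) ≫ (α_ _ _ _).hom) ≫
            (X ⊗ Y) ◁ (c.mul hc ⊗ₘ c.mul hc) := by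
        rw [MonoidalCategory.whiskerLeft_comp, ← Category.assoc, ← hm, hd, hm]
        simp only [Category.assoc, MonoidalCategory.tensorHom_def', comp_whiskerRight]
        rw [whisker_exchange_assoc]
        monoidal
      rw [h5, ← Category.assoc, ← h4]
      simp
    one_comul := by
      have hd := c.comul_spec (𝟙_ B)
      rw [c.coact_unit] at hd
      change c.one ≫ c.comul = (λ_ (𝟙_ B)).inv ≫ (c.one ⊗ₘ c.one)
      rw [← cancel_mono (λ_ (H ⊗ H)).inv]
      calc _ = (c.one ≫ (λ_ H).inv) ≫ 𝟙_ B ◁ c.comul := by simp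
        _ = _ := by
          rw [hd, MonoidalCategory.tensorHom_def']
          monoidal
    mul_counit := by
      refine (c.separating₂ hc).eq fun p => ?_
      obtain ⟨X, Y⟩ := p
      dsimp only
      change c.coact₂ X Y ≫ (X ⊗ Y) ◁ (c.mul hc ≫ c.counit) = c.coact₂ X Y ≫
        (X ⊗ Y) ◁ ((c.counit ⊗ₘ c.counit) ≫ (λ_ (𝟙_ B)).hom)
      have hm := c.mul_spec hc
      have he := c.counit_spec
      have h1 := tensorμ_comp_whiskerLeft X Y c.counit c.counit
      have h2 := rightUnitor_monoidal X Y
      rw [MonoidalCategory.whiskerLeft_comp, ← Category.assoc, ← hm, he,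
        MonoidalCategory.whiskerLeft_comp, Coendomorphism.coact₂, Category.assoc,
        reassoc_of% h1, tensorHom_comp_tensorHom_assoc, he, he,
        ← cancel_mono (ρ_ (X ⊗ Y)).hom, Iso.inv_hom_id, Category.assoc, Category.assoc, ← h2,
        tensorHom_comp_tensorHom]
      simp
    one_counit := by
      have he := c.counit_spec (𝟙_ B)
      rw [c.coact_unit] at he
      change c.one ≫ c.counit = 𝟙 _
      rw [← cancel_mono (λ_ (𝟙_ B)).inv]
      calc _ = (c.one ≫ (λ_ H).inv) ≫ 𝟙_ B ◁ c.counit := by simp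
        _ = _ := by
          rw [he]
          monoidal }

theorem Coendomorphism.exists_halfBraiding (hc : c.IsStrong) (Y : B) :
    ∃ s : H ⊗ Y ⟶ Y ⊗ H, ∀ X, c.coact X ▷ Y ≫ (α_ X H Y).hom ≫ X ◁ s =
      (β_ X Y).hom ≫ Y ◁ c.coact X ≫ (α_ Y X H).inv ≫ (β_ Y X).hom ▷ H ≫ (α_ X Y H).hom := by
  obtain ⟨s, hs, -⟩ := hc Y (Y ⊗ H) (fun X => (β_ X Y).hom ≫ Y ◁ c.coact X ≫ (α_ Y X H).inv ≫
      (β_ Y X).hom ▷ H ≫ (α_ X Y H).hom) (fun {X Z} f => by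
    have h := c.naturality f
    have h1 : Y ◁ f ≫ Y ◁ c.coact Z = Y ◁ c.coact X ≫ Y ◁ (f ▷ H) := by
      rw [← MonoidalCategory.whiskerLeft_comp, h, MonoidalCategory.whiskerLeft_comp]
    rw [BraidedCategory.braiding_naturality_left_assoc, reassoc_of% h1]
    have h3 : Y ◁ (f ▷ H) ≫ (α_ Y Z H).inv ≫ (β_ Y Z).hom ▷ H ≫ (α_ Z Y H).hom =
        (α_ Y X H).inv ≫ (Y ◁ f ≫ (β_ Y Z).hom) ▷ H ≫ (α_ Z Y H).hom := by monoidal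
    rw [h3, BraidedCategory.braiding_naturality_right]
    monoidal)
  exact ⟨s, fun X => (hs X).symm⟩

/-- The canonical half-braiding `H ⊗ Y ⟶ Y ⊗ H` of `H` (in general different from the braiding of
`B`): the morphism that turns the coaction on `X`, followed by it, into the coaction on `X` carried
out after braiding `X` past `Y` and before braiding it back. It makes every `X` a good comodule. -/
noncomputable def Coendomorphism.halfBraiding (hc : c.IsStrong) (Y : B) : H ⊗ Y ⟶ Y ⊗ H :=
  (c.exists_halfBraiding hc Y).choose

theorem Coendomorphism.halfBraiding_spec (hc : c.IsStrong) (X Y : B) :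
    c.coact X ▷ Y ≫ (α_ X H Y).hom ≫ X ◁ c.halfBraiding hc Y =
      (β_ X Y).hom ≫ Y ◁ c.coact X ≫ (α_ Y X H).inv ≫ (β_ Y X).hom ▷ H ≫ (α_ X Y H).hom :=
  (c.exists_halfBraiding hc Y).choose_spec X

end Coend

section Reflective

variable {B : Type u₁} [Category.{v₁} B] [MonoidalCategory B] [BraidedCategory B]
  {M : Type u₂} [Category.{v₂} M] [MonoidalLeftAction B M]

/-- The equations of a module braiding with the object `V` of `M` fixed: naturality in `X`,
`e I = id`, and `e (X ⊗ Y) = (X ⊙ e Y) ∘ (c_{Y,X} ⊙ V) ∘ (Y ⊙ e X) ∘ (c_{Y,X}⁻¹ ⊙ V)`.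
Invertibility is not part of this predicate. -/
structure IsReflective {V : M} (e : ∀ X : B, X ⊙ₗ V ⟶ X ⊙ₗ V) : Prop where
  naturality : ∀ {X Y : B} (f : X ⟶ Y), f ⊵ₗ V ≫ e Y = e X ≫ f ⊵ₗ V
  unit : e (𝟙_ B) = 𝟙 _
  tensor : ∀ X Y : B, e (X ⊗ Y) =
    (β_ Y X).inv ⊵ₗ V ≫ (αₗ Y X V).hom ≫ Y ⊴ₗ e X ≫ (αₗ Y X V).inv ≫
      (β_ Y X).hom ⊵ₗ V ≫ (αₗ X Y V).hom ≫ X ⊴ₗ e Y ≫ (αₗ X Y V).inv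

/-- The transformation on `Y ⊙ V` obtained from one on `V` by the second equation of a module
braiding; this is how `B` acts on the reflective center. -/
def actBraiding {V : M} (e : ∀ X : B, X ⊙ₗ V ⟶ X ⊙ₗ V) (Y X : B) :
    X ⊙ₗ Y ⊙ₗ V ⟶ X ⊙ₗ Y ⊙ₗ V :=
  (αₗ X Y V).inv ≫ (β_ X Y).hom ⊵ₗ V ≫ (αₗ Y X V).hom ≫ Y ⊴ₗ e X ≫ (αₗ Y X V).inv ≫
    (β_ Y X).hom ⊵ₗ V ≫ (αₗ X Y V).hom

variable (B M) in
/-- Objects of the reflective center of the `B`-module category `M`. -/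
structure ReflectiveCenter where
  /-- the underlying object -/
  V : M
  /-- the module braiding -/
  e : ∀ X : B, X ⊙ₗ V ≅ X ⊙ₗ V
  isReflective : IsReflective (fun X => (e X).hom)

namespace ReflectiveCenter

/-- Morphisms of the reflective center: morphisms in `M` that commute with the braidings. -/
@[ext]
structure Hom (Z W : ReflectiveCenter B M) where
  /-- the underlying morphism -/
  hom : Z.V ⟶ W.V
  comm : ∀ X : B, (Z.e X).hom ≫ X ⊴ₗ hom = X ⊴ₗ hom ≫ (W.e X).hom

instance : Category (ReflectiveCenter B M) where
  Hom Z W := Hom Z W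
  id Z := ⟨𝟙 Z.V, fun X => by simp⟩
  comp f g := ⟨f.hom ≫ g.hom, fun X => by
    have h := f.comm X
    rw [actionHomRight_comp, reassoc_of% h, g.comm X, Category.assoc]⟩

variable (B M) in
/-- The forgetful functor `(V, e) ↦ V`. -/
def forget : ReflectiveCenter B M ⥤ M where
  obj Z := Z.V
  map f := f.hom

end ReflectiveCenter

end Reflective

end ReflCenter

namespace ReflCenter

/-! ### The braiding of `B` acting on a module category -/

section Action

variable {B : Type u₁} [Category.{v₁} B] [MonoidalCategory B]
  {M : Type u₂} [Category.{v₂} M] [MonoidalLeftAction B M]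

/-! `M`-strongness with `P = T = V` says that natural families `e X` on `X ⊙ V` are the same as
morphisms `γ : H ⊙ V ⟶ V`, with `e = c.induced γ`. The theorem translates structure across this
bijection.

The component at the unit object is `γ` precomposed with the unit of `H`, so `e I = id` is the unit
law (`induced_unit_eq_id_iff`). For the tensor equation, naturality against the braiding rewrites it
as a formula for `e (X ⊗ Y)` with `e Y` acting first and a single conjugation by the braiding around
`e X` (`tensor_eq_iff_of_naturality`). The two sides are then the two-variable transformations of `γ
∘ (m ⊙ V)` and of `γ ∘ (H ⊙ γ)` (`induced_tensor`, `coactOn₂_comp_comp`). Two-variable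
transformations determine their morphism (`coactOn₂_separating`), so the tensor equation is
associativity of `γ`.

Composition of families is convolution and the identity family comes from the counit
(`induced_comul`, `induced_counit`). The antipode therefore supplies inverses, and invertibility
need not be assumed. Bijectivity for different source and target identifies the morphisms of the two
categories (`comm_iff`).

For the action of `B`, the half-braiding is defined so that `γ'` induces exactly `actBraiding e Y`.
This family is again reflective by Yang–Baxter, so the converse direction makes `γ'` an action. -/

theorem associator_hom_actionHomLeft (X Y Z : B) (P : M) :
    (α_ X Y Z).hom ⊵ₗ P = (αₗ (X ⊗ Y) Z P).hom ≫ (αₗ X Y (Z ⊙ₗ P)).hom ≫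
      X ⊴ₗ (αₗ Y Z P).inv ≫ (αₗ X (Y ⊗ Z) P).inv := by
  rw [← associator_actionHom_assoc]
  simp

theorem associator_inv_actionHomLeft (X Y Z : B) (P : M) :
    (α_ X Y Z).inv ⊵ₗ P = (αₗ X (Y ⊗ Z) P).hom ≫ X ⊴ₗ (αₗ Y Z P).hom ≫
      (αₗ X Y (Z ⊙ₗ P)).inv ≫ (αₗ (X ⊗ Y) Z P).inv := by
  rw [← cancel_epi ((α_ X Y Z).hom ⊵ₗ P), hom_inv_actionHomLeft, associator_hom_actionHomLeft]
  simp

theorem tensorHom_actionHomLeft {X X' Y Y' : B} (f : X ⟶ X') (g : Y ⟶ Y') (P : M) :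
    (f ⊗ₘ g) ⊵ₗ P = (αₗ X Y P).hom ≫ X ⊴ₗ g ⊵ₗ P ≫ f ⊵ₗ (Y' ⊙ₗ P) ≫ (αₗ X' Y' P).inv := by
  rw [MonoidalCategory.tensorHom_def', comp_actionHomLeft, whiskerLeft_actionHomLeft,
    whiskerRight_actionHomLeft]
  simp only [Category.assoc, Iso.inv_hom_id_assoc]

theorem leftUnitor_inv_actionHomLeft (X : B) (P : M) :
    (λ_ X).inv ⊵ₗ P = (λₗ (X ⊙ₗ P)).inv ≫ (αₗ (𝟙_ B) X P).inv := by
  rw [← cancel_epi ((λ_ X).hom ⊵ₗ P), hom_inv_actionHomLeft, leftUnitor_actionHom]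
  simp

theorem rightUnitor_inv_actionHomLeft (X : B) (P : M) :
    (ρ_ X).inv ⊵ₗ P = X ⊴ₗ (λₗ P).inv ≫ (αₗ X (𝟙_ B) P).inv := by
  rw [← cancel_epi ((ρ_ X).hom ⊵ₗ P), hom_inv_actionHomLeft, rightUnitor_actionHom]
  simp

variable [BraidedCategory B]

/-- The braiding of `B`, acting on an object of `M`. -/
def actBraid (X Y : B) (P : M) : X ⊙ₗ Y ⊙ₗ P ≅ Y ⊙ₗ X ⊙ₗ P where
  hom := (αₗ X Y P).inv ≫ (β_ X Y).hom ⊵ₗ P ≫ (αₗ Y X P).hom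
  inv := (αₗ Y X P).inv ≫ (β_ X Y).inv ⊵ₗ P ≫ (αₗ X Y P).hom

theorem braiding_hom_actionHomLeft (X Y : B) (P : M) :
    (β_ X Y).hom ⊵ₗ P = (αₗ X Y P).hom ≫ (actBraid X Y P).hom ≫ (αₗ Y X P).inv := by
  simp [actBraid]

theorem braiding_inv_actionHomLeft (X Y : B) (P : M) :
    (β_ X Y).inv ⊵ₗ P = (αₗ Y X P).hom ≫ (actBraid X Y P).inv ≫ (αₗ X Y P).inv := by
  simp [actBraid]

/-- As in the lemmas that follow, an identity of `B` is applied to `P`, every tensor product is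
expanded into iterated actions, and the outer associators cancel. -/
theorem actBraid_naturality_left {X X' : B} (f : X ⟶ X') (Y : B) (P : M) :
    f ⊵ₗ (Y ⊙ₗ P) ≫ (actBraid X' Y P).hom = (actBraid X Y P).hom ≫ Y ⊴ₗ f ⊵ₗ P := by
  have h := congrArg (· ⊵ₗ P) (BraidedCategory.braiding_naturality_left f Y)
  simp only [comp_actionHomLeft, whiskerLeft_actionHomLeft, whiskerRight_actionHomLeft,
    braiding_hom_actionHomLeft, Category.assoc, Iso.inv_hom_id_assoc, cancel_epi] at h
  simpa only [← Category.assoc, cancel_mono] using h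

theorem actBraid_naturality_middle (X : B) {Y Y' : B} (f : Y ⟶ Y') (P : M) :
    X ⊴ₗ f ⊵ₗ P ≫ (actBraid X Y' P).hom = (actBraid X Y P).hom ≫ f ⊵ₗ (X ⊙ₗ P) := by
  have h := congrArg (· ⊵ₗ P) (BraidedCategory.braiding_naturality_right X f)
  simp only [comp_actionHomLeft, whiskerLeft_actionHomLeft, whiskerRight_actionHomLeft,
    braiding_hom_actionHomLeft, Category.assoc, Iso.inv_hom_id_assoc, cancel_epi] at h
  simpa only [← Category.assoc, cancel_mono] using h

theorem actBraid_naturality_right (X Y : B) {P Q : M} (f : P ⟶ Q) :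
    X ⊴ₗ Y ⊴ₗ f ≫ (actBraid X Y Q).hom = (actBraid X Y P).hom ≫ Y ⊴ₗ X ⊴ₗ f := by
  have h := action_exchange (β_ X Y).hom f
  simp only [tensor_actionHomRight,
    braiding_hom_actionHomLeft, Category.assoc, Iso.inv_hom_id_assoc, cancel_epi] at h
  simpa only [← Category.assoc, cancel_mono] using h

theorem actBraid_tensor_right (X Y Z : B) (P : M) :
    (actBraid X (Y ⊗ Z) P).hom = X ⊴ₗ (αₗ Y Z P).hom ≫ (actBraid X Y (Z ⊙ₗ P)).hom ≫
      Y ⊴ₗ (actBraid X Z P).hom ≫ (αₗ Y Z (X ⊙ₗ P)).inv := by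
  have h := congrArg (· ⊵ₗ P) (BraidedCategory.braiding_tensor_right_hom X Y Z)
  simp only [comp_actionHomLeft, whiskerLeft_actionHomLeft, whiskerRight_actionHomLeft,
    braiding_hom_actionHomLeft, associator_inv_actionHomLeft, associator_hom_actionHomLeft,
    actionHomRight_comp, actionHomRight_inv_hom_assoc,
    Category.assoc, Iso.inv_hom_id_assoc, cancel_epi] at h
  simpa only [← Category.assoc, cancel_mono] using h

theorem actBraid_tensor_left (X Y Z : B) (P : M) :
    (actBraid (X ⊗ Y) Z P).hom = (αₗ X Y (Z ⊙ₗ P)).hom ≫ X ⊴ₗ (actBraid Y Z P).hom ≫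
      (actBraid X Z (Y ⊙ₗ P)).hom ≫ Z ⊴ₗ (αₗ X Y P).inv := by
  have h := congrArg (· ⊵ₗ P) (BraidedCategory.braiding_tensor_left_hom X Y Z)
  simp only [comp_actionHomLeft, whiskerLeft_actionHomLeft, whiskerRight_actionHomLeft,
    braiding_hom_actionHomLeft, associator_inv_actionHomLeft, associator_hom_actionHomLeft,
    actionHomRight_comp, actionHomRight_inv_hom_assoc,
    Category.assoc, Iso.inv_hom_id_assoc, cancel_epi] at h
  simpa only [← Category.assoc, cancel_mono] using h

/-- Naturality of the braiding with `Z` along the morphism `β_ X Y`, with both sides expanded by the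
hexagon. -/
theorem actBraid_yang_baxter (X Y Z : B) (P : M) :
    X ⊴ₗ (actBraid Y Z P).hom ≫ (actBraid X Z (Y ⊙ₗ P)).hom ≫ Z ⊴ₗ (actBraid X Y P).hom =
      (actBraid X Y (Z ⊙ₗ P)).hom ≫ Y ⊴ₗ (actBraid X Z P).hom ≫
        (actBraid Y Z (X ⊙ₗ P)).hom := by
  have h := actBraid_naturality_left (β_ X Y).hom Z P
  simp only [actBraid_tensor_left, braiding_hom_actionHomLeft, actionHomRight_comp,
    actionHomRight_inv_hom_assoc, Category.assoc, Iso.inv_hom_id_assoc, cancel_epi] at h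
  simp only [← Category.assoc, cancel_mono] at h
  simpa only [Category.assoc] using h.symm

theorem isReflective_tensor_iff {V : M} (e : ∀ X : B, X ⊙ₗ V ⟶ X ⊙ₗ V) (X Y : B) :
    (e (X ⊗ Y) = (β_ Y X).inv ⊵ₗ V ≫ (αₗ Y X V).hom ≫ Y ⊴ₗ e X ≫ (αₗ Y X V).inv ≫
      (β_ Y X).hom ⊵ₗ V ≫ (αₗ X Y V).hom ≫ X ⊴ₗ e Y ≫ (αₗ X Y V).inv) ↔
    e (X ⊗ Y) = (αₗ X Y V).hom ≫ (actBraid Y X V).inv ≫ Y ⊴ₗ e X ≫ (actBraid Y X V).hom ≫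
      X ⊴ₗ e Y ≫ (αₗ X Y V).inv := by
  simp only [braiding_hom_actionHomLeft, braiding_inv_actionHomLeft, Category.assoc,
    Iso.inv_hom_id_assoc]

/-- By naturality with respect to the braiding, the second equation of a module braiding can be
rewritten with the braidings on the outside. -/
theorem tensor_eq_iff_of_naturality {V : M} (e : ∀ X : B, X ⊙ₗ V ⟶ X ⊙ₗ V)
    (he : ∀ {X Y : B} (f : X ⟶ Y), f ⊵ₗ V ≫ e Y = e X ≫ f ⊵ₗ V) (X Y : B) :
    e (Y ⊗ X) = (αₗ Y X V).hom ≫ (actBraid X Y V).inv ≫ X ⊴ₗ e Y ≫ (actBraid X Y V).hom ≫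
        Y ⊴ₗ e X ≫ (αₗ Y X V).inv ↔
      e (X ⊗ Y) = (αₗ X Y V).hom ≫ X ⊴ₗ e Y ≫ (actBraid X Y V).hom ≫ Y ⊴ₗ e X ≫
        (actBraid X Y V).inv ≫ (αₗ X Y V).inv := by
  have h := he (β_ X Y).hom
  rw [← IsIso.eq_inv_comp] at h
  rw [h, inv_actionHomLeft, IsIso.Iso.inv_hom, braiding_hom_actionHomLeft,
    braiding_inv_actionHomLeft]
  simp only [Category.assoc, cancel_epi]
  rw [← cancel_mono ((αₗ Y X V).hom ≫ (actBraid X Y V).inv), ← cancel_epi (αₗ X Y V).inv]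
  simp only [Category.assoc, Iso.inv_hom_id_assoc, Iso.hom_inv_id, Category.comp_id]
  rw [Iso.inv_comp_eq, ← cancel_mono (αₗ X Y V).inv]
  simp only [Category.assoc, Iso.hom_inv_id, Category.comp_id]
  exact (Iso.inv_comp_eq _).symm

theorem actBraiding_eq {V : M} (e : ∀ X : B, X ⊙ₗ V ⟶ X ⊙ₗ V) (Y X : B) :
    actBraiding e Y X = (actBraid X Y V).hom ≫ Y ⊴ₗ e X ≫ (actBraid Y X V).hom := by
  simp [actBraiding, actBraid]

/-- The action of `B` preserves module braidings. -/
theorem IsReflective.actBraiding {V : M} {e : ∀ X : B, X ⊙ₗ V ⟶ X ⊙ₗ V} (he : IsReflective e)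
    (Y : B) : IsReflective (actBraiding e Y) where
  naturality {X Z} f := by
    rw [actBraiding_eq, actBraiding_eq, reassoc_of% @actBraid_naturality_left, Category.assoc,
      Category.assoc, ← actBraid_naturality_middle, ← actionHomRight_comp_assoc, he.naturality,
      actionHomRight_comp_assoc]
  unit := by
    rw [actBraiding_eq, he.unit]
    simp [actBraid, leftUnitor_inv_actionHomLeft, rightUnitor_inv_actionHomLeft]
  tensor X Z := by
    rw [isReflective_tensor_iff]
    have h := he.tensor X Z
    rw [isReflective_tensor_iff] at h
    simp only [actBraiding_eq, h, actBraid_tensor_left, actBraid_tensor_right,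
      actionHomRight_comp, Category.assoc, actionHomRight_inv_hom_assoc,
      cancel_epi]
    -- Yang–Baxter for `Z`, `X`, `Y` with the crossing of `Z` and `X` inverted. It moves the `Y`
    -- strand through the inverse braiding at the start of the tensor equation. The plain form moves
    -- it through the crossing between `e X` and `e Z`.
    have yb : X ⊴ₗ (actBraid Z Y V).hom ≫ (actBraid X Y (Z ⊙ₗ V)).hom ≫
        Y ⊴ₗ (actBraid Z X V).inv =
        (actBraid Z X (Y ⊙ₗ V)).inv ≫ Z ⊴ₗ (actBraid X Y V).hom ≫
          (actBraid Z Y (X ⊙ₗ V)).hom := by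
      rw [Iso.eq_inv_comp, ← reassoc_of% @actBraid_yang_baxter]
      simp
    rw [reassoc_of% @actBraid_yang_baxter, reassoc_of% @actBraid_naturality_right,
      ← reassoc_of% (actBraid_naturality_right Y X), reassoc_of% yb,
      reassoc_of% (actBraid_naturality_right Z Y)]

end Action

namespace Coendomorphism

/-! ### The universal coaction on a module category and induced transformations -/

section Coaction

variable {B : Type u₁} [Category.{v₁} B] [MonoidalCategory B]
  {M : Type u₂} [Category.{v₂} M] [MonoidalLeftAction B M] {H : B} (c : Coendomorphism H)

/-- The universal coaction on `X`, acting on an object of `M`. -/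
def coactOn (X : B) (P : M) : X ⊙ₗ P ⟶ X ⊙ₗ H ⊙ₗ P :=
  c.coact X ⊵ₗ P ≫ (αₗ X H P).hom

theorem coact_actionHomLeft (X : B) (P : M) :
    c.coact X ⊵ₗ P = c.coactOn X P ≫ (αₗ X H P).inv := by
  simp [coactOn]

theorem induced_eq {P T : M} (f : H ⊙ₗ P ⟶ T) (X : B) :
    c.induced f X = c.coactOn X P ≫ X ⊴ₗ f := by
  simp [coactOn, induced]

theorem coactOn_naturality {X Y : B} (f : X ⟶ Y) (P : M) :
    f ⊵ₗ P ≫ c.coactOn Y P = c.coactOn X P ≫ f ⊵ₗ (H ⊙ₗ P) := by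
  have h := congrArg (· ⊵ₗ P) (c.naturality f)
  simp only [comp_actionHomLeft, whiskerRight_actionHomLeft, coact_actionHomLeft, Category.assoc,
    Iso.inv_hom_id_assoc] at h
  simpa only [← Category.assoc, cancel_mono] using h

theorem coactOn_naturality_right (X : B) {P Q : M} (f : P ⟶ Q) :
    X ⊴ₗ f ≫ c.coactOn X Q = c.coactOn X P ≫ X ⊴ₗ H ⊴ₗ f := by
  rw [coactOn, coactOn, action_exchange_assoc, tensor_actionHomRight]
  simp only [Category.assoc, Iso.inv_hom_id, Category.comp_id]

theorem induced_naturality {P T : M} (f : H ⊙ₗ P ⟶ T) {X Y : B} (g : X ⟶ Y) :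
    g ⊵ₗ P ≫ c.induced f Y = c.induced f X ≫ g ⊵ₗ T := by
  rw [induced_eq, induced_eq, reassoc_of% @coactOn_naturality, ← action_exchange, Category.assoc]

/-- The injective half of strongness; it applies because induced transformations are natural. -/
theorem IsStrongOver.ext {c : Coendomorphism H} (hM : c.IsStrongOver M) {P T : M}
    {f g : H ⊙ₗ P ⟶ T} (h : ∀ X, c.induced f X = c.induced g X) : f = g :=
  (hM P T (c.induced f) (c.induced_naturality f)).unique (fun _ => rfl) h

theorem induced_comp {P Q T : M} (f : H ⊙ₗ P ⟶ Q) (g : Q ⟶ T) (X : B) :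
    c.induced (f ≫ g) X = c.induced f X ≫ X ⊴ₗ g := by
  simp [induced_eq]

theorem induced_precomp {P Q T : M} (f : P ⟶ Q) (g : H ⊙ₗ Q ⟶ T) (X : B) :
    c.induced (H ⊴ₗ f ≫ g) X = X ⊴ₗ f ≫ c.induced g X := by
  rw [induced_eq, induced_eq, reassoc_of% @coactOn_naturality_right, actionHomRight_comp]

theorem coactOn_counit (X : B) (P : M) :
    c.coactOn X P ≫ X ⊴ₗ (c.counit ⊵ₗ P ≫ (λₗ P).hom) = 𝟙 _ := by
  have h := congrArg (· ⊵ₗ P) (c.counit_spec X)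
  simp only [comp_actionHomLeft, whiskerLeft_actionHomLeft, rightUnitor_inv_actionHomLeft,
    coact_actionHomLeft, Category.assoc, Iso.inv_hom_id_assoc] at h
  simp only [← Category.assoc, cancel_mono] at h
  rw [actionHomRight_comp, reassoc_of% h, actionHomRight_inv_hom]

theorem coactOn_comul (X : B) (P : M) :
    c.coactOn X P ≫ X ⊴ₗ (c.comul ⊵ₗ P ≫ (αₗ H H P).hom) =
      c.coactOn X P ≫ c.coactOn X (H ⊙ₗ P) := by
  have h := congrArg (· ⊵ₗ P) (c.comul_spec X)
  simp only [comp_actionHomLeft, whiskerLeft_actionHomLeft, whiskerRight_actionHomLeft,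
    associator_hom_actionHomLeft,
    coact_actionHomLeft, Category.assoc, Iso.inv_hom_id_assoc] at h
  rw [actionHomRight_comp,
    ← cancel_mono (X ⊴ₗ (αₗ H H P).inv ≫ (αₗ X (H ⊗ H) P).inv)]
  simpa using h

theorem coactOn_unit (P : M) :
    c.coactOn (𝟙_ B) P = (λₗ P).hom ≫ (λₗ P).inv ≫ c.one ⊵ₗ P ≫ (λₗ (H ⊙ₗ P)).inv := by
  rw [coactOn, c.coact_unit, comp_actionHomLeft, leftUnitor_inv_actionHomLeft]
  simp

theorem induced_unit {P T : M} (f : H ⊙ₗ P ⟶ T) :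
    c.induced f (𝟙_ B) = c.one ⊵ₗ P ≫ f ≫ (λₗ T).inv := by
  rw [induced_eq, coactOn_unit, unit_actionHomRight]
  simp

theorem induced_counit (P : M) (X : B) : c.induced (c.counit ⊵ₗ P ≫ (λₗ P).hom) X = 𝟙 _ := by
  rw [induced_eq, coactOn_counit]

/-- Composition of induced transformations is given by the convolution product. -/
theorem induced_comul {P Q T : M} (f : H ⊙ₗ P ⟶ Q) (g : H ⊙ₗ Q ⟶ T) (X : B) :
    c.induced (c.comul ⊵ₗ P ≫ (αₗ H H P).hom ≫ H ⊴ₗ f ≫ g) X =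
      c.induced f X ≫ c.induced g X := by
  rw [← Category.assoc, induced_eq, actionHomRight_comp, reassoc_of% @coactOn_comul, induced_eq,
    induced_eq, actionHomRight_comp, Category.assoc, reassoc_of% @coactOn_naturality_right]

/-- Matches the normalization of a module braiding with the unit law of an action. -/
theorem induced_unit_eq_id_iff {V : M} (f : H ⊙ₗ V ⟶ V) :
    c.induced f (𝟙_ B) = 𝟙 _ ↔ c.one ⊵ₗ V ≫ f = (λₗ V).hom := by
  rw [induced_unit, ← Category.assoc, Iso.comp_inv_eq, Category.id_comp]

/-- Both sides of the left-hand equation are themselves induced, by `f ≫ k` and by `H ⊴ₗ k ≫ g`, so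
injectivity applies. This identifies morphisms of the center with module morphisms. -/
theorem IsStrongOver.comm_iff {c : Coendomorphism H} (hM : c.IsStrongOver M) {V W : M}
    (f : H ⊙ₗ V ⟶ V) (g : H ⊙ₗ W ⟶ W) (k : V ⟶ W) :
    (∀ X, c.induced f X ≫ X ⊴ₗ k = X ⊴ₗ k ≫ c.induced g X) ↔ f ≫ k = H ⊴ₗ k ≫ g := by
  simp only [← c.induced_comp, ← c.induced_precomp]
  exact ⟨hM.ext, fun h X => by rw [h]⟩

/-! ### Two-variable transformations and the half-braiding -/

variable [BraidedCategory B]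

/-- The coactions on `X` and `Y`, with the first copy of `H` moved past `Y`. -/
def coactOn₂ (X Y : B) (P : M) : X ⊙ₗ Y ⊙ₗ P ⟶ X ⊙ₗ Y ⊙ₗ H ⊙ₗ H ⊙ₗ P :=
  X ⊴ₗ c.coactOn Y P ≫ c.coactOn X (Y ⊙ₗ H ⊙ₗ P) ≫ X ⊴ₗ (actBraid H Y (H ⊙ₗ P)).hom

theorem coact₂_actionHomLeft (X Y : B) (P : M) :
    c.coact₂ X Y ⊵ₗ P = (αₗ X Y P).hom ≫ c.coactOn₂ X Y P ≫
      X ⊴ₗ Y ⊴ₗ (αₗ H H P).inv ≫ (αₗ X Y ((H ⊗ H) ⊙ₗ P)).inv ≫ (αₗ (X ⊗ Y) (H ⊗ H) P).inv := by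
  rw [coact₂, tensorμ]
  simp only [comp_actionHomLeft, tensorHom_actionHomLeft, whiskerLeft_actionHomLeft,
    whiskerRight_actionHomLeft, coact_actionHomLeft, associator_hom_actionHomLeft,
    associator_inv_actionHomLeft, braiding_hom_actionHomLeft, coactOn₂, actionHomRight_comp,
    Category.assoc, Iso.inv_hom_id_assoc, actionHomRight_inv_hom_assoc, cancel_epi]
  rw [← reassoc_of% @coactOn_naturality_right, actionHomRight_inv_hom_assoc]

theorem coactOn_tensor (hc : c.IsStrong) (X Y : B) (P : M) :
    c.coactOn (X ⊗ Y) P = (αₗ X Y P).hom ≫ c.coactOn₂ X Y P ≫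
      X ⊴ₗ Y ⊴ₗ ((αₗ H H P).inv ≫ c.mul hc ⊵ₗ P) ≫ (αₗ X Y (H ⊙ₗ P)).inv := by
  rw [coactOn, c.mul_spec hc]
  simp [coact₂_actionHomLeft, associator_inv_actionHomLeft]

/-- The transformation of two variables induced by a morphism out of `H ⊙ H ⊙ P`. -/
theorem coactOn₂_comp (X Y : B) {P T : M} (g : H ⊙ₗ H ⊙ₗ P ⟶ T) :
    c.coactOn₂ X Y P ≫ X ⊴ₗ Y ⊴ₗ g = c.induced
      (H ⊴ₗ c.coactOn Y P ≫ (actBraid H Y (H ⊙ₗ P)).hom ≫ Y ⊴ₗ g) X := by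
  rw [coactOn₂, induced_precomp, induced_eq]
  simp only [actionHomRight_comp, Category.assoc]

/-- By naturality of the braiding along `c.coact X` and the hexagon for `X ⊗ H`, moving `X` and its
new copy of `H` past `Y` together amounts to moving `X` past `Y` before coacting. -/
theorem induced_actBraid (X Y : B) {P T : M} (g : H ⊙ₗ P ⟶ T) :
    c.induced ((actBraid H Y P).hom ≫ Y ⊴ₗ g) X =
      (actBraid X Y P).hom ≫ Y ⊴ₗ c.induced g X ≫ (actBraid X Y T).inv := by
  have h : c.coactOn X (Y ⊙ₗ P) ≫ X ⊴ₗ (actBraid H Y P).hom ≫ (actBraid X Y (H ⊙ₗ P)).hom =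
      (actBraid X Y P).hom ≫ Y ⊴ₗ c.coactOn X P := by
    have h := actBraid_naturality_left (c.coact X) Y P
    simp only [actBraid_tensor_left, coact_actionHomLeft, Category.assoc, Iso.inv_hom_id_assoc,
      actionHomRight_comp] at h
    simpa only [← Category.assoc, cancel_mono] using h
  rw [← Category.assoc, Iso.eq_comp_inv, induced_eq, induced_eq, actionHomRight_comp,
    actionHomRight_comp, ← reassoc_of% h, ← actBraid_naturality_right]
  simp only [Category.assoc]

/-- Naturality of the braiding of `H` along `c.coact Y`, with the hexagon for `Y ⊗ H`. Stopping
after `Y` alone leaves an inverse crossing of the two copies of `H`. -/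
theorem coactOn_actBraid (Y : B) (P : M) :
    (actBraid H Y P).inv ≫ H ⊴ₗ c.coactOn Y P ≫ (actBraid H Y (H ⊙ₗ P)).hom =
      c.coactOn Y (H ⊙ₗ P) ≫ Y ⊴ₗ (actBraid H H P).inv := by
  have h := actBraid_naturality_middle H (c.coact Y) P
  simp only [actBraid_tensor_right, coact_actionHomLeft, Category.assoc,
    actionHomRight_inv_hom_assoc, actionHomRight_comp] at h
  simp only [← Category.assoc, cancel_mono] at h
  rw [Iso.inv_comp_eq, ← cancel_mono (Y ⊴ₗ (actBraid H H P).hom)]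
  simpa using h

/-- Strongness is used once per variable. The inverse crossing of the two copies of `H` is composed
in front so that `coactOn_actBraid` exhibits the dependence on `Y` as an ordinary induced
transformation. -/
theorem coactOn₂_separating (hM : c.IsStrongOver M) {P T : M} {f g : H ⊙ₗ H ⊙ₗ P ⟶ T}
    (h : ∀ X Y, c.coactOn₂ X Y P ≫ X ⊴ₗ Y ⊴ₗ f = c.coactOn₂ X Y P ≫ X ⊴ₗ Y ⊴ₗ g) : f = g := by
  rw [← cancel_epi (actBraid H H P).inv]
  refine hM.ext fun Y => ?_
  simp only [induced_eq, actionHomRight_comp, ← Category.assoc, ← coactOn_actBraid]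
  simp only [Category.assoc, cancel_epi]
  refine hM.ext fun X => ?_
  rw [← coactOn₂_comp, ← coactOn₂_comp, h]

/-- The braiding slides past `f`, so `f` combines with the coaction on `Y` and `g` with the coaction
on `X`. This is how an iterated action becomes the right-hand side of the rewritten tensor equation.
-/
theorem coactOn₂_comp_comp (X Y : B) {P Q T : M} (f : H ⊙ₗ P ⟶ Q) (g : H ⊙ₗ Q ⟶ T) :
    c.coactOn₂ X Y P ≫ X ⊴ₗ Y ⊴ₗ (H ⊴ₗ f ≫ g) =
      X ⊴ₗ c.induced f Y ≫ (actBraid X Y Q).hom ≫ Y ⊴ₗ c.induced g X ≫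
        (actBraid X Y T).inv := by
  rw [coactOn₂_comp, ← induced_actBraid, ← induced_precomp, induced_eq c f]
  congr 1
  simp only [actionHomRight_comp, reassoc_of% @actBraid_naturality_right, Category.assoc]

theorem coactOn_halfBraiding (hc : c.IsStrong) (X Y : B) (P : M) :
    c.coactOn X (Y ⊙ₗ P) ≫ X ⊴ₗ ((αₗ H Y P).inv ≫ c.halfBraiding hc Y ⊵ₗ P ≫ (αₗ Y H P).hom) =
      (actBraid X Y P).hom ≫ Y ⊴ₗ c.coactOn X P ≫ (actBraid Y X (H ⊙ₗ P)).hom := by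
  have h := congrArg (· ⊵ₗ P) (c.halfBraiding_spec hc X Y)
  simp only [comp_actionHomLeft, whiskerLeft_actionHomLeft, whiskerRight_actionHomLeft,
    associator_hom_actionHomLeft, associator_inv_actionHomLeft, braiding_hom_actionHomLeft,
    coact_actionHomLeft, Category.assoc, Iso.inv_hom_id_assoc, actionHomRight_comp,
    actionHomRight_inv_hom_assoc, cancel_epi] at h
  simp only [← Category.assoc, cancel_mono] at h
  rw [← cancel_mono (X ⊴ₗ (αₗ Y H P).inv)]
  simpa using h

end Coaction

/-! ### Actions of `H` and module braidings -/

section Module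

variable {B : Type u₁} [Category.{v₁} B] [MonoidalCategory B] [BraidedCategory B]
  {M : Type u₂} [Category.{v₂} M] [MonoidalLeftAction B M] {H : B} {c : Coendomorphism H}

theorem induced_tensor (hc : c.IsStrong) {P T : M} (f : H ⊙ₗ P ⟶ T) (X Y : B) :
    c.induced f (X ⊗ Y) = (αₗ X Y P).hom ≫
      (c.coactOn₂ X Y P ≫ X ⊴ₗ Y ⊴ₗ ((αₗ H H P).inv ≫ c.mul hc ⊵ₗ P ≫ f)) ≫
        (αₗ X Y T).inv := by
  simp [induced_eq, coactOn_tensor c hc]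

theorem isReflective_induced (hc : c.IsStrong) {V : M} {f : H ⊙ₗ V ⟶ V}
    (h_one : c.one ⊵ₗ V ≫ f = (λₗ V).hom)
    (h_mul : c.mul hc ⊵ₗ V ≫ f = (αₗ H H V).hom ≫ H ⊴ₗ f ≫ f) :
    IsReflective (c.induced f) where
  naturality := c.induced_naturality f
  unit := (c.induced_unit_eq_id_iff f).2 h_one
  -- The names are swapped because `tensor_eq_iff_of_naturality` turns the equation at `(Y, X)` into
  -- a formula for the component at `X ⊗ Y`.
  tensor Y X := by
    rw [isReflective_tensor_iff, tensor_eq_iff_of_naturality _ (c.induced_naturality f),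
      induced_tensor hc, h_mul, Iso.inv_hom_id_assoc, coactOn₂_comp_comp]
    simp only [Category.assoc]

/-- The argument of `isReflective_induced` read backwards; `coactOn₂_separating` strips off the two
coactions. -/
theorem IsStrongOver.mul_comp_of_isReflective (hM : c.IsStrongOver M) (hc : c.IsStrong) {V : M}
    {f : H ⊙ₗ V ⟶ V} (hf : IsReflective (c.induced f)) :
    c.mul hc ⊵ₗ V ≫ f = (αₗ H H V).hom ≫ H ⊴ₗ f ≫ f := by
  rw [← Iso.inv_comp_eq]
  refine c.coactOn₂_separating hM fun X Y => ?_
  have h := hf.tensor Y X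
  rw [isReflective_tensor_iff, tensor_eq_iff_of_naturality _ (c.induced_naturality f),
    induced_tensor hc] at h
  rw [coactOn₂_comp_comp]
  simp only [Category.assoc, cancel_epi] at h
  simpa only [← Category.assoc, cancel_mono] using h

/-- The defining equation of the half-braiding, acting on `V`, followed by sliding `f` past the last
braiding. -/
theorem induced_halfBraiding (hc : c.IsStrong) (Y : B) {V : M} (f : H ⊙ₗ V ⟶ V) (X : B) :
    c.induced ((αₗ H Y V).inv ≫ c.halfBraiding hc Y ⊵ₗ V ≫ (αₗ Y H V).hom ≫ Y ⊴ₗ f) X =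
      actBraiding (c.induced f) Y X := by
  have h := c.coactOn_halfBraiding hc X Y V
  have e : (αₗ H Y V).inv ≫ c.halfBraiding hc Y ⊵ₗ V ≫ (αₗ Y H V).hom ≫ Y ⊴ₗ f =
      ((αₗ H Y V).inv ≫ c.halfBraiding hc Y ⊵ₗ V ≫ (αₗ Y H V).hom) ≫ Y ⊴ₗ f := by simp
  rw [e, induced_eq, actionHomRight_comp, reassoc_of% h, actBraiding_eq, induced_eq,
    actionHomRight_comp, Category.assoc, actBraid_naturality_right]

variable [HopfObj H]

theorem IsStrongOver.modObj_ext (hM : c.IsStrongOver M) {V : M} {m m' : ModObj H V}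
    (hm : ∀ X, c.induced m.smul X = c.induced m'.smul X) : m = m' := by
  have hs : m.smul = m'.smul := hM.ext hm
  cases m
  congr 1

/-- The bialgebra structure underlying the given Hopf algebra structure is the canonical one. -/
structure IsCanonical (c : Coendomorphism H) (hc : c.IsStrong) : Prop where
  one_eq : η[H] = c.one
  mul_eq : μ[H] = c.mul hc
  counit_eq : ε[H] = c.counit
  comul_eq : Δ[H] = c.comul

theorem isCanonical_of_eq (hc : c.IsStrong)
    (hH : HopfObj.toBimonObj (X := H) = c.bimonObj hc) : c.IsCanonical hc where
  one_eq := congrArg (fun b : BimonObj H => b.toMonObj.one) hH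
  mul_eq := congrArg (fun b : BimonObj H => b.toMonObj.mul) hH
  counit_eq := congrArg (fun b : BimonObj H => b.toComonObj.counit) hH
  comul_eq := congrArg (fun b : BimonObj H => b.toComonObj.comul) hH

/-! ### Invertibility from the antipode, and the equivalence of categories -/

namespace IsCanonical

variable {hc : c.IsStrong} (h : c.IsCanonical hc)

theorem isReflective_smul (h : c.IsCanonical hc) (V : M) [ModObj H V] :
    IsReflective (c.induced (ModObj.smul (M := H) (X := V))) :=
  isReflective_induced hc (by rw [← h.one_eq, ModObj.one_smul])
    (by rw [← h.mul_eq, ModObj.mul_smul])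

/-- The transformation induced by an action is invertible; the inverse is induced by acting through
the antipode. -/
@[simps] def inducedIso (V : M) [ModObj H V] (X : B) : X ⊙ₗ V ≅ X ⊙ₗ V where
  hom := c.induced (ModObj.smul (M := H) (X := V)) X
  inv := c.induced (HopfObj.antipode (X := H) ⊵ₗ V ≫ ModObj.smul (M := H) (X := V)) X
  hom_inv_id := by
    -- In `induced_comul` the transformation applied last uses the first leg of the
    -- comultiplication, so here the antipode sits on the left leg. The other composite puts it on
    -- the right leg.
    have e := congrArg (· ⊵ₗ V ≫ ModObj.smul (M := H) (X := V)) (HopfObj.antipode_left H)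
    simp only [comp_actionHomLeft, Category.assoc, ModObj.mul_smul, ModObj.one_smul,
      whiskerRight_actionHomLeft, Iso.inv_hom_id_assoc] at e
    rw [← induced_comul, ← h.comul_eq, action_exchange_assoc, e, h.counit_eq, induced_counit]
  inv_hom_id := by
    have e := congrArg (· ⊵ₗ V ≫ ModObj.smul (M := H) (X := V)) (HopfObj.antipode_right H)
    simp only [comp_actionHomLeft, Category.assoc, ModObj.mul_smul, ModObj.one_smul,
      whiskerLeft_actionHomLeft, Iso.inv_hom_id_assoc] at e
    rw [← induced_comul, ← h.comul_eq, actionHomRight_comp, Category.assoc, e, h.counit_eq,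
      induced_counit]

/-- The action whose induced transformation is a given module braiding. -/
@[reducible] noncomputable def modObj (hM : c.IsStrongOver M) {V : M}
    {e : ∀ X : B, X ⊙ₗ V ⟶ X ⊙ₗ V} (he : IsReflective e) : ModObj H V :=
  have hs := (hM V V e he.naturality).choose_spec.1
  -- The equations for `e` are transported to the family induced by the chosen morphism.
  have hr : IsReflective (c.induced (hM V V e he.naturality).choose) := funext hs ▸ he
  { smul := (hM V V e he.naturality).choose
    one_smul := by rw [h.one_eq]; exact (c.induced_unit_eq_id_iff _).1 hr.unit
    mul_smul := by rw [h.mul_eq]; exact hM.mul_comp_of_isReflective hc hr }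

theorem induced_modObj_smul (hM : c.IsStrongOver M) {V : M}
    {e : ∀ X : B, X ⊙ₗ V ⟶ X ⊙ₗ V} (he : IsReflective e) (X : B) :
    e X = c.induced (h.modObj hM he).smul X :=
  (hM V V e he.naturality).choose_spec.1 X

/-- The functor from the reflective center to modules. -/
noncomputable def toMod (hM : c.IsStrongOver M) : ReflectiveCenter B M ⥤ Mod M H where
  obj Z := { X := Z.V, mod := h.modObj hM Z.isReflective }
  map {Z W} f :=
    letI := h.modObj hM Z.isReflective
    letI := h.modObj hM W.isReflective
    Mod.Hom.mk'' f.hom ((hM.comm_iff _ _ _).1 fun X => by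
      simpa only [← h.induced_modObj_smul hM] using f.comm X)
  map_id _ := rfl
  map_comp _ _ := rfl

instance (hM : c.IsStrongOver M) : (h.toMod hM).Faithful where
  map_injective hfg := ReflectiveCenter.Hom.ext (congrArg Mod.Hom.hom hfg)

instance (hM : c.IsStrongOver M) : (h.toMod hM).Full where
  map_surjective {Z W} f := ⟨⟨f.hom, fun X => by
    have hf := (hM.comm_iff _ _ _).2 f.isModHom.smul_hom X
    rwa [h.induced_modObj_smul hM Z.isReflective, h.induced_modObj_smul hM W.isReflective]⟩, rfl⟩

instance (hM : c.IsStrongOver M) : (h.toMod hM).EssSurj where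
  mem_essImage N := by
    let Z : ReflectiveCenter B M := ⟨N.X, h.inducedIso N.X, h.isReflective_smul N.X⟩
    -- The action recovered from the induced braiding is the original one on the same carrier, so
    -- the isomorphism comes from an equality.
    have hN : h.modObj hM Z.isReflective = N.mod :=
      hM.modObj_ext fun X => (h.induced_modObj_smul hM Z.isReflective X).symm
    exact ⟨Z, ⟨eqToIso (congrArg (fun m => CategoryTheory.Mod.mk N.X (mod := m)) hN)⟩⟩

instance (hM : c.IsStrongOver M) : (h.toMod hM).IsEquivalence where

end IsCanonical

end Module

end Coendomorphism

end ReflCenter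

/-! ### The main theorem -/

theorem mainTheorem1
    {B : Type u₁} [Category.{v₁} B] [MonoidalCategory B] [BraidedCategory B]
    {H : B} (c : ReflCenter.Coendomorphism H) (hc : c.IsStrong)
    [HopfObj H] (hH : HopfObj.toBimonObj (X := H) = c.bimonObj hc)
    {M : Type u₂} [Category.{v₂} M] [MonoidalLeftAction B M] (hM : c.IsStrongOver M) :
    -- the reflective center is equivalent, over `M`, to the category of left `H`-modules in `M`,
    -- and the braiding of `(V, e)` is the one induced by the corresponding `H`-action
    (∃ (E : ReflCenter.ReflectiveCenter B M ≌ Mod M H)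
        (φ : E.functor ⋙ Mod.forget H ≅ ReflCenter.ReflectiveCenter.forget B M),
      ∀ (Z : ReflCenter.ReflectiveCenter B M) (X : B),
        X ⊴ₗ φ.hom.app Z ≫ (Z.e X).hom =
          c.induced (ModObj.smul (M := H) (X := (E.functor.obj Z).X)) X ≫ X ⊴ₗ φ.hom.app Z) ∧
    -- every `H`-action induces a transformation satisfying the module-braiding equations
    (∀ (V : M) [ModObj H V], ReflCenter.IsReflective (c.induced (ModObj.smul (M := H) (X := V)))) ∧
    -- every such transformation comes from a unique `H`-action, and is invertible
    (∀ (V : M) (e : ∀ X : B, X ⊙ₗ V ⟶ X ⊙ₗ V), ReflCenter.IsReflective e →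
      (∃! m : ModObj H V, ∀ X, e X = c.induced m.smul X) ∧ ∀ X, IsIso (e X)) ∧
    -- the correspondence is compatible with the actions of `B`
    (∀ (V : M) [ModObj H V] (Y : B), ∃ m : ModObj H (Y ⊙ₗ V),
      m.smul = (αₗ H Y V).inv ≫ c.halfBraiding hc Y ⊵ₗ V ≫ (αₗ Y H V).hom ≫
        Y ⊴ₗ ModObj.smul (M := H) (X := V) ∧
      ∀ X, c.induced m.smul X =
        ReflCenter.actBraiding (c.induced (ModObj.smul (M := H) (X := V))) Y X) := by
  have h := ReflCenter.Coendomorphism.isCanonical_of_eq hc hH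
  refine ⟨⟨(h.toMod hM).asEquivalence, Iso.refl _, fun Z X => ?_⟩, fun V _ => h.isReflective_smul V,
    fun V e he => ⟨⟨h.modObj hM he, h.induced_modObj_smul hM he, fun m hm => ?_⟩, fun X => ?_⟩,
    fun V _ Y => ?_⟩
  · have hZ := h.induced_modObj_smul hM Z.isReflective X
    -- The functor keeps underlying objects and morphisms, so the comparison with the forgetful
    -- functor is the identity.
    change X ⊴ₗ 𝟙 Z.V ≫ (Z.e X).hom =
      c.induced (h.modObj hM Z.isReflective).smul X ≫ X ⊴ₗ 𝟙 Z.V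
    rw [← hZ, actionHomRight_id, Category.id_comp, Category.comp_id]
  · exact hM.modObj_ext fun X => (hm X).symm.trans (h.induced_modObj_smul hM he X)
  · let _ := h.modObj hM he
    rw [h.induced_modObj_smul hM he]
    exact (h.inducedIso V X).isIso_hom
  · have hr := (h.isReflective_smul V).actBraiding Y
    have hs := c.induced_halfBraiding hc Y (ModObj.smul (M := H) (X := V))
    -- The module axioms for the action through the half-braiding are not checked directly: it
    -- induces the same family as the action obtained from `hr`, hence equals it.
    have hm : (h.modObj hM hr).smul = (αₗ H Y V).inv ≫ c.halfBraiding hc Y ⊵ₗ V ≫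
        (αₗ Y H V).hom ≫ Y ⊴ₗ ModObj.smul (M := H) (X := V) :=
      hM.ext fun X => (h.induced_modObj_smul hM hr X).symm.trans (hs X).symm
    exact ⟨h.modObj hM hr, hm, fun X => (h.induced_modObj_smul hM hr X).symm⟩
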